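/- Let $x,y\in\mathbb R$ satisfy $x^2+y^2+x+y+xy=0$ and $-1\le x\le \tfrac13$, and let $$C=\begin{pmatrix} x & y & -1-x-y\\ -1-x-y & x & y\\ y & -1-x-y & x\end{pmatrix}$$ (the matrices of this form make up the class $\mathcal Y$). Consider the three-state quantum walk on $\ell^2(\mathbb Z)\otimes\mathbb C^3$ with one-step operator $U=S(I\otimes C)$, where $$S=\sum_{m\in\mathbb Z}\bigl(|m-1\rangle\langle m|\otimes|1\rangle\langle 1|+|m\rangle\langle m|\otimes|2\rangle\langle 2|+|m+1\rangle\langle m|\otimes|3\rangle\langle 3|\bigr),$$ started from $|0\rangle\otimes\varphi$ with $\varphi=(\alpha,\beta,\gamma)^T\in\mathbb C^3$, $|\alpha|^2+|\beta|^2+|\gamma|^2=1$. Let $P(m,t)=\sum_{l=1}^3\bigl|\langle m,l|U^t|0,\varphi\rangle\bigr|^2$ be the probability of finding the walker at $m$ after $t$ steps. Assume $x\ne 0$ and $x\neq -1$. Then for every such $\varphi$ the limit $\lim_{t\to\infty}P(0,t)$ exists, and the following are equivalent: 1. $\lim_{t\to\infty}P(0,t)=0$; 2. up to a global phase, $\varphi$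 is the state $$\Psi_{\mathcal Y}=\frac1N\bigl(-(1+x+y),\;1+x,\;y\bigr)^T,\qquad N=\sqrt{(1+x+y)^2+(1+x)^2+y^2},$$ that is, $\varphi=c\,\Psi_{\mathcal Y}$ for some $c\in\mathbb C$ with $|c|=1$; 3. $D=E=0$, where $D=\alpha(1+x)+\beta(1+x+y)$ and $E=\gamma(1+x)-\beta y$. Moreover, for every $k\in\mathbb R$ the matrix $\tilde U(k)=\operatorname{diag}(e^{ik},1,e^{-ik})\,C$, which describes the walk in momentum space, has the eigenvalue $-1$, and $\Psi_{\mathcal Y}$ is orthogonal to every eigenvector of $\tilde U(k)$ for this eigenvalue. -/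

import Mathlib

open Filter Topology

noncomputable section

namespace ThreeStateWalk

/-- The state space `ℓ²(ℤ) ⊗ ℂ³`, realised as `ℓ²(ℤ × {1,2,3})`; the coordinate at `(m, l)` is the
amplitude of `|m⟩ ⊗ |l⟩`. The coin labels `1, 2, 3` are the elements `0, 1, 2` of `Fin 3`. -/
abbrev State : Type := lp (fun _ : ℤ × Fin 3 => ℂ) 2

/-- Displacement of the walker for each coin label: left, stay, right. -/
def disp : Fin 3 → ℤ := ![-1, 0, 1]

theorem memlp_comp {f : ℤ × Fin 3 → ℂ} (hf : Memℓp (E := fun _ : ℤ × Fin 3 => ℂ) f 2)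
    {g : ℤ × Fin 3 → ℤ × Fin 3} (hg : Function.Injective g) :
    Memℓp (E := fun _ : ℤ × Fin 3 => ℂ) (fun p => f (g p)) 2 := by
  have h2 : 0 < (2 : ENNReal).toReal := by norm_num
  rw [memℓp_gen_iff h2] at hf ⊢
  exact hf.comp_injective hg

theorem memlp_coin (C : Matrix (Fin 3) (Fin 3) ℂ) {f : ℤ × Fin 3 → ℂ}
    (hf : Memℓp (E := fun _ : ℤ × Fin 3 => ℂ) f 2) :
    Memℓp (E := fun _ : ℤ × Fin 3 => ℂ) (fun p => ∑ j, C p.2 j * f (p.1, j)) 2 := by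
  have h2 : 0 < (2 : ENNReal).toReal := by norm_num
  have key : ∀ j : Fin 3,
      Memℓp (E := fun _ : ℤ × Fin 3 => ℂ) (fun p => C p.2 j * f (p.1, j)) 2 := by
    intro j
    have hj : Summable fun m : ℤ => ‖f (m, j)‖ ^ (2 : ENNReal).toReal :=
      ((memℓp_gen_iff h2).1 hf).comp_injective
        (i := fun m : ℤ => (m, j)) (fun a b h => (Prod.mk.inj h).1)
    rw [memℓp_gen_iff h2]
    have hfin : Summable fun l : Fin 3 => ‖C l j‖ ^ (2 : ENNReal).toReal :=
      Summable.of_finite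
    have hprod := hj.mul_of_nonneg hfin (fun _ => by positivity) (fun _ => by positivity)
    refine hprod.congr fun p => ?_
    rw [norm_mul, Real.mul_rpow (norm_nonneg _) (norm_nonneg _), mul_comm]
  exact Memℓp.finsetSum Finset.univ fun j _ => key j

/-- The conditional shift
`S = ∑ₘ (|m-1⟩⟨m| ⊗ |1⟩⟨1| + |m⟩⟨m| ⊗ |2⟩⟨2| + |m+1⟩⟨m| ⊗ |3⟩⟨3|)`. -/
def shift : State →ₗ[ℂ] State where
  toFun ψ := ⟨fun p => ψ (p.1 - disp p.2, p.2), memlp_comp (lp.memℓp ψ)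
    (g := fun p => (p.1 - disp p.2, p.2)) (by
      rintro ⟨a, l⟩ ⟨b, l'⟩ h
      obtain ⟨h1, rfl⟩ := Prod.mk.inj h
      exact Prod.ext (sub_left_injective h1) rfl)⟩
  map_add' _ _ := rfl
  map_smul' _ _ := rfl

/-- The operator `I ⊗ C`. -/
def coinOp (C : Matrix (Fin 3) (Fin 3) ℂ) : State →ₗ[ℂ] State where
  toFun ψ := ⟨fun p => ∑ j, C p.2 j * ψ (p.1, j), memlp_coin C (lp.memℓp ψ)⟩
  map_add' ψ φ := by
    ext p
    change ∑ j, C p.2 j * (ψ (p.1, j) + φ (p.1, j))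
      = ∑ j, C p.2 j * ψ (p.1, j) + ∑ j, C p.2 j * φ (p.1, j)
    simp only [mul_add, Finset.sum_add_distrib]
  map_smul' c ψ := by
    ext p
    change ∑ j, C p.2 j * (c * ψ (p.1, j)) = c * ∑ j, C p.2 j * ψ (p.1, j)
    simp only [Finset.mul_sum, mul_left_comm]

/-- One step of the walk, `U = S (I ⊗ C)`. -/
def evolution (C : Matrix (Fin 3) (Fin 3) ℂ) : Module.End ℂ State :=
  shift ∘ₗ coinOp C

/-- The initial state `|0⟩ ⊗ φ`. -/
def initial (φ : EuclideanSpace ℂ (Fin 3)) : State :=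
  ∑ l, lp.single 2 ((0 : ℤ), l) (φ l)

/-- `P(m,t)`: the probability of finding the walker at `m` after `t` steps, when it starts at the
origin with coin state `φ`. -/
def prob (C : Matrix (Fin 3) (Fin 3) ℂ) (φ : EuclideanSpace ℂ (Fin 3)) (m : ℤ) (t : ℕ) : ℝ :=
  ∑ l, ‖((evolution C ^ t) (initial φ)) (m, l)‖ ^ 2

/-- The coin with parameters `x, y`. -/
def coin (x y : ℝ) : Matrix (Fin 3) (Fin 3) ℝ :=
  !![x, y, -1 - x - y;
     -1 - x - y, x, y;
     y, -1 - x - y, x]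

/-- The coin class `𝒴`. -/
def coinClassY : Set (Matrix (Fin 3) (Fin 3) ℝ) :=
  {C | ∃ x y : ℝ, x ^ 2 + y ^ 2 + x + y + x * y = 0 ∧ -1 ≤ x ∧ x ≤ 1 / 3 ∧ C = coin x y}

/-- A real matrix regarded as a complex one. -/
def toComplex (C : Matrix (Fin 3) (Fin 3) ℝ) : Matrix (Fin 3) (Fin 3) ℂ :=
  C.map (fun r => (r : ℂ))

/-- The evolution in momentum space, `diag(e^{ik}, 1, e^{-ik}) C`. -/
def momentumEvolution (C : Matrix (Fin 3) (Fin 3) ℂ) (k : ℝ) : Matrix (Fin 3) (Fin 3) ℂ :=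
  Matrix.diagonal ![Complex.exp (Complex.I * k), 1, Complex.exp (-(Complex.I * k))] * C

/-- The unit vector `(1/N) (-(1+x+y), 1+x, y)ᵀ`, `N = √((1+x+y)² + (1+x)² + y²)`. -/
def exceptionalState (x y : ℝ) : EuclideanSpace ℂ (Fin 3) :=
  ((1 / √((1 + x + y) ^ 2 + (1 + x) ^ 2 + y ^ 2) : ℝ) : ℂ) •
    !₂[-(1 + (x : ℂ) + (y : ℂ)), 1 + (x : ℂ), (y : ℂ)]

end ThreeStateWalk

end

/-!
In momentum space the characteristic polynomial of the walk `V` is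
`(λ + 1) (λ² - (1 + x + 2 x cos k) λ + 1)`. In position space this says
`(V + 1) (V² - 2 H V + 1) = 0`, where `H = (1 + x) / 2 + (x / 2) (T + T⁻¹)` is a self-adjoint
contraction built from the unit translation `T` and commuting with `V`. Hence `V ^ n (V + 1)` is
governed by the Chebyshev polynomials `U_n(H)`. The commutator of `T_n(H)` with the position
operator is a multiple of `n (T - T⁻¹) U_{n-1}(H)`, and `‖T_n(H)‖ ≤ 1`, so the matrix entries of
`(T - T⁻¹) U_{n-1}(H)` are `O(1 / n)`. It follows that `V ^ n` decays at every site on the vectors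
`(V + 1) (T - T⁻¹) |m, l⟩`, which span a dense subspace of the orthogonal complement of
`ker (V + 1)`.

Therefore `P(0, t)` tends to `‖(P (|0⟩ ⊗ φ)) (0, ·)‖²`, where `P` is the orthogonal projection onto
`ker (V + 1)`, and this limit vanishes exactly when `|0⟩ ⊗ φ` is orthogonal to `ker (V + 1)`. The
component of `V ξ = -ξ` with label `2` at the origin says that `ξ (0, ·)` is orthogonal to `Ψ_𝒴`.
Conversely, pairing `|0⟩ ⊗ φ` with the two translates of a compactly supported bound state that
touch the origin gives `D = E = 0`, which determines `φ` up to a phase.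
-/

noncomputable section

namespace ThreeStateWalk

open Polynomial Module.End

section Chebyshev

theorem commute_aeval_right {R A : Type*} [CommSemiring R] [Semiring A] [Algebra R A] {a b : A}
    (h : Commute a b) (f : R[X]) : Commute a (aeval b f) := by
  induction f using Polynomial.induction_on' with
  | add f g hf hg => rw [map_add]; exact hf.add_right hg
  | monomial d c =>
    rw [aeval_monomial]
    exact (Algebra.commute_algebraMap_right c a).mul_right (h.pow_right d)

theorem pow_add_one_mul_eq_aeval_chebyshev_U {R A : Type*} [CommRing R] [Ring A] [Algebra R A]
    {v h w : A} (hvh : Commute v h) (hrec : v * v * w = 2 * h * (v * w) - w) (n : ℕ) :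
    v ^ (n + 1) * w =
      aeval h (Chebyshev.U R n) * (v * w) - aeval h (Chebyshev.U R (n - 1)) * w := by
  have hcomm (f : R[X]) : v * aeval h f = aeval h f * v := commute_aeval_right hvh f
  induction n with
  | zero => simp
  | succ n ih =>
    have hU : aeval h (Chebyshev.U R (n + 1)) =
        aeval h (Chebyshev.U R n) * (2 * h) - aeval h (Chebyshev.U R (n - 1)) := by
      rw [Chebyshev.U_add_one, mul_comm]
      simp only [map_sub, map_mul, aeval_X, map_ofNat]
    calc v ^ (n + 1 + 1) * w
        = v * aeval h (Chebyshev.U R n) * (v * w) - v * aeval h (Chebyshev.U R (n - 1)) * w := by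
          rw [pow_succ', mul_assoc, ih]; noncomm_ring
      _ = aeval h (Chebyshev.U R n) * (v * v * w) -
            aeval h (Chebyshev.U R (n - 1)) * (v * w) := by
          rw [hcomm, hcomm]; noncomm_ring
      _ = _ := by
          rw [hrec, Nat.cast_succ, hU, add_sub_cancel_right]; noncomm_ring

theorem norm_aeval_chebyshev_T_le_one {A : Type*} [CStarAlgebra A] {a : A} (ha : IsSelfAdjoint a)
    (hnorm : ‖a‖ ≤ 1) (n : ℤ) : ‖aeval a (Chebyshev.T ℂ n)‖ ≤ 1 := by
  nontriviality A
  have : IsStarNormal a := ha.isStarNormal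
  rw [← cfc_polynomial (Chebyshev.T ℂ n) a]
  refine norm_cfc_le zero_le_one fun z hz => ?_
  have hre : |z.re| ≤ 1 :=
    (Complex.abs_re_le_norm z).trans ((spectrum.norm_le_norm_of_mem hz).trans hnorm)
  rw [ha.mem_spectrum_eq_re hz, ← Chebyshev.complex_ofReal_eval_T, Complex.norm_real]
  exact Chebyshev.abs_eval_T_real_le_one n hre

end Chebyshev

section Decay

theorem map_eq_smul_of_inner_map_self_eq {𝕜 E : Type*} [RCLike 𝕜] [NormedAddCommGroup E]
    [InnerProductSpace 𝕜 E] {V : E →L[𝕜] E} (hV : ‖V‖ ≤ 1) {μ : 𝕜} (hμ : ‖μ‖ = 1) {ξ : E}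
    (h : inner 𝕜 ξ (V ξ) = μ * inner 𝕜 ξ ξ) : V ξ = μ • ξ := by
  refine eq_of_norm_le_re_inner_eq_norm_sq (𝕜 := 𝕜) ?_ ?_
  · simpa [norm_smul, hμ] using V.le_of_opNorm_le hV ξ
  · have hinner : inner 𝕜 (V ξ) (μ • ξ) = inner 𝕜 ξ ξ := by
      rw [inner_smul_right, ← inner_conj_symm, h]
      simp [← mul_assoc, RCLike.mul_conj, hμ]
    rw [hinner, norm_smul, hμ, one_mul, inner_self_eq_norm_sq]

theorem pow_apply_of_apply_eq_smul {𝕜 E : Type*} [NormedField 𝕜] [SeminormedAddCommGroup E]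
    [NormedSpace 𝕜 E] {V : E →L[𝕜] E} {μ : 𝕜} {ξ : E} (h : V ξ = μ • ξ) (t : ℕ) :
    (V ^ t) ξ = μ ^ t • ξ := by
  induction t with
  | zero => simp
  | succ t ih => rw [pow_succ', mul_apply_eq_comp, ih, map_smul, h, smul_smul, pow_succ]

variable {ι : Type*} {V : lp (fun _ : ι => ℂ) 2 →L[ℂ] lp (fun _ : ι => ℂ) 2}

/-- The vectors of `ℓ²(ι)` all of whose coordinates tend to zero under iteration of `V`. When `V` is
a contraction, these are the vectors whose orbit converges weakly to zero. -/
def decaying (V : lp (fun _ : ι => ℂ) 2 →L[ℂ] lp (fun _ : ι => ℂ) 2) :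
    Submodule ℂ (lp (fun _ : ι => ℂ) 2) where
  carrier := {ψ | ∀ i, Tendsto (fun t : ℕ => (V ^ t) ψ i) atTop (𝓝 0)}
  add_mem' ha hb i := by simpa using (ha i).add (hb i)
  zero_mem' i := by simp
  smul_mem' c a ha i := by simpa using (ha i).const_mul c

theorem isClosed_decaying (hV : ‖V‖ ≤ 1) :
    IsClosed (decaying V : Set (lp (fun _ : ι => ℂ) 2)) := by
  have hlip (i : ι) (t : ℕ) : LipschitzWith 1 fun ψ => (V ^ t) ψ i := by
    refine LipschitzWith.of_dist_le_mul fun ψ χ => ?_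
    have hVt : ‖V ^ t‖ ≤ 1 := by
      cases t with
      | zero => exact ContinuousLinearMap.norm_id_le
      | succ t => exact (norm_pow_le' V t.succ_pos).trans (pow_le_one₀ (norm_nonneg _) hV)
    calc dist ((V ^ t) ψ i) ((V ^ t) χ i)
        = ‖(V ^ t) (ψ - χ) i‖ := by simp [dist_eq_norm]
      _ ≤ ‖(V ^ t) (ψ - χ)‖ := lp.norm_apply_le_norm two_ne_zero _ i
      _ ≤ (1 : NNReal) * dist ψ χ := by
          rw [dist_eq_norm]; exact (V ^ t).le_of_opNorm_le hVt _
  have hclosed (i : ι) : IsClosed {ψ | Tendsto (fun t : ℕ => (V ^ t) ψ i) atTop (𝓝 0)} :=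
    (LipschitzWith.uniformEquicontinuous _ 1 (hlip i)).equicontinuous.isClosed_setOfPred_tendsto
      continuous_const
  have hinter : (decaying V : Set (lp (fun _ : ι => ℂ) 2)) =
      ⋂ i, {ψ | Tendsto (fun t : ℕ => (V ^ t) ψ i) atTop (𝓝 0)} := by
    ext ψ; simp [decaying]
  rw [hinter]
  exact isClosed_iInter hclosed

theorem tendsto_norm_pow_apply {μ : ℂ} (hμ : ‖μ‖ = 1)
    (hdecay : (eigenspace (V : Module.End ℂ _) μ)ᗮ ≤ decaying V) (ψ : lp (fun _ : ι => ℂ) 2)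
    (i : ι) :
    Tendsto (fun t : ℕ => ‖(V ^ t) ψ i‖) atTop
      (𝓝 ‖(eigenspace (V : Module.End ℂ _) μ).starProjection ψ i‖) := by
  set ξ := (eigenspace (V : Module.End ℂ _) μ).starProjection ψ
  have hξ : V ξ = μ • ξ := mem_eigenspace_iff.1 (Submodule.starProjection_apply_mem _ ψ)
  have hrest : Tendsto (fun t : ℕ => ‖(V ^ t) (ψ - ξ) i‖) atTop (𝓝 0) := by
    simpa using (hdecay (Submodule.sub_starProjection_mem_orthogonal ψ) i).norm
  refine tendsto_iff_norm_sub_tendsto_zero.2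
    (squeeze_zero (fun _ => norm_nonneg _) (fun t => ?_) hrest)
  calc ‖‖(V ^ t) ψ i‖ - ‖ξ i‖‖
      = |‖(V ^ t) ψ i‖ - ‖(V ^ t) ξ i‖| := by
        simp [pow_apply_of_apply_eq_smul hξ, hμ]
    _ ≤ ‖(V ^ t) (ψ - ξ) i‖ := by
        simpa using abs_norm_sub_norm_le ((V ^ t) ψ i) ((V ^ t) ξ i)

end Decay

section Hopping

/-- The isometry of the state space induced by a permutation of the basis states. -/
def reindex (e : Equiv.Perm (ℤ × Fin 3)) : State →ₗᵢ[ℂ] State where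
  toFun ψ := ⟨fun p => ψ (e p), memlp_comp (lp.memℓp ψ) e.injective⟩
  map_add' _ _ := rfl
  map_smul' _ _ := rfl
  norm_map' ψ := by
    have h2 : 0 < (2 : ENNReal).toReal := by norm_num
    rw [lp.norm_eq_tsum_rpow h2, lp.norm_eq_tsum_rpow h2]
    exact congrArg (· ^ _) (e.tsum_eq fun p => ‖ψ p‖ ^ _)

theorem reindex_apply (e : Equiv.Perm (ℤ × Fin 3)) (ψ : State) (p : ℤ × Fin 3) :
    reindex e ψ p = ψ (e p) := rfl

theorem inner_reindex_left (e : Equiv.Perm (ℤ × Fin 3)) (ξ ψ : State) :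
    inner ℂ (reindex e ξ) ψ = inner ℂ ξ (reindex e.symm ψ) := by
  rw [lp.inner_eq_tsum, lp.inner_eq_tsum, ← e.symm.tsum_eq]
  simp only [reindex_apply, Equiv.apply_symm_apply]

/-- The translation `T ^ d` of the walker by `d` sites. -/
def translate (d : ℤ) : State →L[ℂ] State :=
  (reindex ((Equiv.subRight d).prodCongr (Equiv.refl _))).toContinuousLinearMap

theorem translate_apply (d : ℤ) (ψ : State) (m : ℤ) (l : Fin 3) :
    translate d ψ (m, l) = ψ (m - d, l) := rfl

theorem norm_translate_le (d : ℤ) : ‖translate d‖ ≤ 1 :=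
  LinearIsometry.norm_toContinuousLinearMap_le _

theorem adjoint_translate (d : ℤ) : (translate d).adjoint = translate (-d) := by
  refine ((ContinuousLinearMap.eq_adjoint_iff _ _).2 fun ξ ψ => ?_).symm
  refine (inner_reindex_left _ _ _).trans (congrArg _ (lp.ext (funext fun p => ?_)))
  rw [reindex_apply]
  exact congrArg (fun m => ψ (m, p.2)) (by simp [sub_eq_add_neg])

theorem eq_zero_of_translate_eq_self {d : ℤ} (hd : d ≠ 0) {ζ : State} (hζ : translate d ζ = ζ) :
    ζ = 0 := by
  ext ⟨m, l⟩
  have hperiodic (n : ℕ) : ζ (m - n * d, l) = ζ (m, l) := by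
    induction n with
    | zero => simp
    | succ n ih =>
      have hstep := translate_apply d ζ (m - n * d) l
      rwa [hζ, ih, sub_sub, ← add_one_mul, ← Nat.cast_succ, eq_comm] at hstep
  have hinj : Function.Injective fun n : ℕ => (m - n * d, l) := fun a b hab => by
    simpa [hd] using hab
  have hsummable : Summable fun n : ℕ => ‖ζ (m - n * d, l)‖ ^ 2 := by
    have := (lp.hasSum_norm (p := 2) (by norm_num) ζ).summable.comp_injective hinj
    simpa [Function.comp_def] using this
  have hlim := hsummable.tendsto_atTop_zero
  simp only [hperiodic] at hlim
  simpa using tendsto_nhds_unique tendsto_const_nhds hlim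

/-- The operator `a + b (T + T⁻¹)`, where `T` is the translation by one site. -/
def hopping (a b : ℝ) : State →L[ℂ] State :=
  (a : ℂ) • 1 + (b : ℂ) • (translate 1 + translate (-1))

theorem hopping_apply (a b : ℝ) (ψ : State) (m : ℤ) (l : Fin 3) :
    hopping a b ψ (m, l) = a * ψ (m, l) + b * (ψ (m - 1, l) + ψ (m + 1, l)) := by
  rw [← sub_neg_eq_add m 1]
  rfl

theorem commute_translate_hopping (d : ℤ) (a b : ℝ) : Commute (translate d) (hopping a b) := by
  ext ψ ⟨m, l⟩
  simp only [mul_apply_eq_comp, translate_apply, hopping_apply, sub_right_comm, sub_add_eq_add_sub]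

theorem isSelfAdjoint_hopping (a b : ℝ) : IsSelfAdjoint (hopping a b) := by
  simp [hopping, IsSelfAdjoint, ContinuousLinearMap.star_eq_adjoint, adjoint_translate, add_comm]

theorem norm_hopping_le (a b : ℝ) : ‖hopping a b‖ ≤ |a| + 2 * |b| := by
  have h1 : ‖(a : ℂ) • (1 : State →L[ℂ] State)‖ ≤ |a| := by
    rw [norm_smul, Complex.norm_real, Real.norm_eq_abs]
    exact mul_le_of_le_one_right (abs_nonneg a) ContinuousLinearMap.norm_id_le
  have h2 : ‖(b : ℂ) • (translate 1 + translate (-1))‖ ≤ |b| * 2 := by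
    rw [norm_smul, Complex.norm_real, Real.norm_eq_abs]
    gcongr
    linarith [norm_add_le (translate 1) (translate (-1)), norm_translate_le 1,
      norm_translate_le (-1)]
  calc ‖hopping a b‖ ≤ |a| + |b| * 2 := norm_add_le_of_le h1 h2
    _ = |a| + 2 * |b| := by rw [mul_comm |b|]

/-- The basis state `|m⟩ ⊗ |l⟩`, for `p = (m, l)`. -/
abbrev basisState (p : ℤ × Fin 3) : State := lp.single 2 p (1 : ℂ)

/- The commutator of the position operator with `f(H)` is `b (T - T⁻¹) f'(H)`. -/
theorem sub_mul_aeval_hopping_basisState_apply (a b : ℝ) (f : ℂ[X]) (n m : ℤ) (j l : Fin 3) :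
    (m - n) * aeval (hopping a b) f (basisState (n, j)) (m, l) =
      b * aeval (hopping a b) (derivative f)
        ((translate 1 - translate (-1)) (basisState (n, j))) (m, l) := by
  induction f using Polynomial.induction_on generalizing m with
  | C c =>
    by_cases hmn : m = n
    · simp [hmn]
    · simp [hmn, aeval_C, Algebra.algebraMap_eq_smul_one, lp.single_apply]
  | add f g hf hg =>
    simp only [map_add, add_apply, lp.coeFn_add, Pi.add_apply, mul_add, hf, hg]
  | monomial d c ih =>
    set g : ℂ[X] := C c * X ^ d
    have hXg : C c * X ^ (d + 1) = X * g := by simp only [g, pow_succ]; ring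
    have hleft (k : ℤ) : aeval (hopping a b) g
        ((translate 1 - translate (-1)) (basisState (n, j))) (k, l) =
          aeval (hopping a b) g (basisState (n, j)) (k - 1, l) -
            aeval (hopping a b) g (basisState (n, j)) (k + 1, l) := by
      have hcomm (d : ℤ) : aeval (hopping a b) g (translate d (basisState (n, j))) =
          translate d (aeval (hopping a b) g (basisState (n, j))) :=
        DFunLike.congr_fun (commute_aeval_right (commute_translate_hopping d a b) g).symm.eq _
      simp only [sub_apply, map_sub, hcomm, lp.coeFn_sub, Pi.sub_apply, translate_apply,
        sub_neg_eq_add]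
    rw [hXg, derivative_mul, derivative_X, one_mul]
    simp only [map_add, map_mul, aeval_X, add_apply, mul_apply_eq_comp, lp.coeFn_add, Pi.add_apply,
      hopping_apply, hleft]
    have ih1 := ih (m - 1)
    have ih2 := ih (m + 1)
    push_cast at ih1 ih2
    linear_combination a * ih m + b * (ih1 + ih2)

/- Chebyshev polynomials of a contraction are contractions, so `T_n' = n U_{n-1}` makes the matrix
elements of `U_{n-1}(H) (T - T⁻¹)` of order `1 / n`. -/
theorem tendsto_aeval_chebyshev_U_hopping {a b : ℝ} (hb : b ≠ 0) (hab : ‖hopping a b‖ ≤ 1)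
    (p q : ℤ × Fin 3) :
    Tendsto (fun n : ℕ => aeval (hopping a b) (Chebyshev.U ℂ n)
      ((translate 1 - translate (-1)) (basisState q)) p) atTop (𝓝 0) := by
  obtain ⟨m, l⟩ := p
  obtain ⟨n, j⟩ := q
  set D := (translate 1 - translate (-1)) (basisState (n, j))
  have hbound (k : ℕ) : ‖aeval (hopping a b) (Chebyshev.U ℂ k) D (m, l)‖ ≤
      ‖((m : ℂ) - n) / b‖ / ((k + 1 : ℕ) : ℝ) := by
    have hcomm := sub_mul_aeval_hopping_basisState_apply a b (Chebyshev.T ℂ (k + 1)) n m j l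
    have hT : ‖aeval (hopping a b) (Chebyshev.T ℂ (k + 1)) (basisState (n, j)) (m, l)‖ ≤ 1 := by
      refine (lp.norm_apply_le_norm two_ne_zero _ _).trans ?_
      refine (ContinuousLinearMap.le_of_opNorm_le _
        (norm_aeval_chebyshev_T_le_one (isSelfAdjoint_hopping a b) hab _) _).trans ?_
      simp
    have hU : ((k + 1 : ℕ) : ℂ) * aeval (hopping a b) (Chebyshev.U ℂ k) D (m, l) =
        (m - n) / b * aeval (hopping a b) (Chebyshev.T ℂ (k + 1)) (basisState (n, j)) (m, l) := by
      rw [Chebyshev.T_derivative_eq_U, add_sub_cancel_right, ← zsmul_eq_mul,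
        ← Int.cast_smul_eq_zsmul ℂ, map_smul, smul_apply, lp.coeFn_smul, Pi.smul_apply,
        smul_eq_mul] at hcomm
      have hb' : (b : ℂ) ≠ 0 := Complex.ofReal_ne_zero.2 hb
      push_cast at hcomm ⊢
      field_simp
      linear_combination -hcomm
    rw [le_div_iff₀' (by positivity), ← Complex.norm_natCast, ← norm_mul, hU, norm_mul]
    exact mul_le_of_le_one_right (norm_nonneg _) hT
  exact squeeze_zero_norm hbound
    ((tendsto_const_div_atTop_nhds_zero_nat _).comp (tendsto_add_atTop_nat 1))

end Hopping

section Walk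

variable {C : Matrix (Fin 3) (Fin 3) ℂ}

theorem evolution_apply (C : Matrix (Fin 3) (Fin 3) ℂ) (ψ : State) (m : ℤ) (l : Fin 3) :
    evolution C ψ (m, l) = ∑ j, C l j * ψ (m - disp l, j) := rfl

theorem evolution_translate (C : Matrix (Fin 3) (Fin 3) ℂ) (d : ℤ) (ψ : State) :
    evolution C (translate d ψ) = translate d (evolution C ψ) := by
  ext ⟨m, l⟩
  simp only [translate_apply, evolution_apply, sub_right_comm]

/-- The bijection of the basis states that underlies the conditional shift. -/
def shiftEquiv : Equiv.Perm (ℤ × Fin 3) where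
  toFun p := (p.1 - disp p.2, p.2)
  invFun p := (p.1 + disp p.2, p.2)
  left_inv p := by simp
  right_inv p := by simp

theorem norm_shift (ψ : State) : ‖shift ψ‖ = ‖ψ‖ := (reindex shiftEquiv).norm_map ψ

theorem norm_coinOp (hC : C ∈ Matrix.unitaryGroup (Fin 3) ℂ) (ψ : State) : ‖coinOp C ψ‖ = ‖ψ‖ := by
  have hsite (v : Fin 3 → ℂ) : ∑ l, ‖∑ j, C l j * v j‖ ^ 2 = ∑ l, ‖v l‖ ^ 2 := by
    have hmem : Matrix.toEuclideanCLM (𝕜 := ℂ) C ∈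
        unitary (EuclideanSpace ℂ (Fin 3) →L[ℂ] EuclideanSpace ℂ (Fin 3)) :=
      Unitary.map_mem Matrix.toEuclideanCLM hC
    have := ContinuousLinearMap.norm_map_of_mem_unitary hmem (WithLp.toLp 2 v)
    rw [← sq_eq_sq₀ (norm_nonneg _) (norm_nonneg _), EuclideanSpace.norm_sq_eq,
      EuclideanSpace.norm_sq_eq] at this
    simpa [Matrix.mulVec, dotProduct] using this
  have hsummable (χ : State) : Summable fun p => ‖χ p‖ ^ 2 := by
    simpa using (lp.hasSum_norm (p := 2) (by norm_num) χ).summable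
  have hnorm (χ : State) : ‖χ‖ ^ 2 = ∑' m : ℤ, ∑ l, ‖χ (m, l)‖ ^ 2 := by
    have h := lp.norm_rpow_eq_tsum (p := 2) (by norm_num) χ
    simp only [ENNReal.toReal_ofNat, Real.rpow_ofNat] at h
    rw [h, (hsummable χ).tsum_prod]
    simp only [tsum_fintype]
  rw [← sq_eq_sq₀ (norm_nonneg _) (norm_nonneg _), hnorm, hnorm]
  exact tsum_congr fun m => hsite fun j => ψ (m, j)

/-- The walk with unitary coin `C`, as a bounded operator. -/
def walk (hC : C ∈ Matrix.unitaryGroup (Fin 3) ℂ) : State →L[ℂ] State :=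
  LinearIsometry.toContinuousLinearMap
    ⟨evolution C, fun ψ => (norm_shift _).trans (norm_coinOp hC ψ)⟩

theorem walk_apply (hC : C ∈ Matrix.unitaryGroup (Fin 3) ℂ) (ψ : State) :
    walk hC ψ = evolution C ψ := rfl

theorem coe_walk_pow (hC : C ∈ Matrix.unitaryGroup (Fin 3) ℂ) (t : ℕ) (ψ : State) :
    (walk hC ^ t) ψ = (evolution C ^ t) ψ := by
  rw [← ContinuousLinearMap.coe_coe, ContinuousLinearMap.toLinearMap_pow]
  rfl

theorem norm_walk_le (hC : C ∈ Matrix.unitaryGroup (Fin 3) ℂ) : ‖walk hC‖ ≤ 1 :=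
  LinearIsometry.norm_toContinuousLinearMap_le _

theorem commute_walk_hopping (hC : C ∈ Matrix.unitaryGroup (Fin 3) ℂ) (a b : ℝ) :
    Commute (walk hC) (hopping a b) := by
  have htranslate (d : ℤ) : Commute (walk hC) (translate d) :=
    ContinuousLinearMap.ext (evolution_translate C d)
  exact ((Commute.one_right _).smul_right _).add_right
    (((htranslate 1).add_right (htranslate (-1))).smul_right _)

theorem tendsto_walk_apply (hC : C ∈ Matrix.unitaryGroup (Fin 3) ℂ) {u : ℕ → State}
    (hu : ∀ p, Tendsto (fun n => u n p) atTop (𝓝 0)) (p : ℤ × Fin 3) :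
    Tendsto (fun n => walk hC (u n) p) atTop (𝓝 0) := by
  have hsum := tendsto_finsetSum Finset.univ fun j _ => (hu (p.1 - disp p.2, j)).const_mul (C p.2 j)
  simp only [mul_zero, Finset.sum_const_zero] at hsum
  exact hsum

section Recurrence

variable {hC : C ∈ Matrix.unitaryGroup (Fin 3) ℂ} {a b : ℝ}

theorem walk_add_one_mem_decaying (hb : b ≠ 0) (hab : ‖hopping a b‖ ≤ 1)
    (hrec : walk hC * walk hC * (walk hC + 1) =
      2 * hopping a b * (walk hC * (walk hC + 1)) - (walk hC + 1)) (q : ℤ × Fin 3) :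
    (walk hC + 1) ((translate 1 - translate (-1)) (basisState q)) ∈ decaying (walk hC) := by
  set D := (translate 1 - translate (-1)) (basisState q)
  set V := walk hC
  set W : ℕ → State →L[ℂ] State := fun n => aeval (hopping a b) (Chebyshev.U ℂ n)
  have hpow (n : ℕ) : V ^ (n + 2) * (V + 1) =
      V * (V * W (n + 1)) + V * W (n + 1) - (V * W n + W n) := by
    have hcomm (k : ℕ) : W k * V = V * W k :=
      (commute_aeval_right (commute_walk_hopping hC a b) _).symm
    have h := pow_add_one_mul_eq_aeval_chebyshev_U (R := ℂ) (commute_walk_hopping hC a b) hrec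
      (n + 1)
    rw [Nat.cast_succ, add_sub_cancel_right] at h
    calc V ^ (n + 2) * (V + 1) = W (n + 1) * (V * (V + 1)) - W n * (V + 1) := h
      _ = W (n + 1) * V * V + W (n + 1) * V - (W n * V + W n) := by noncomm_ring
      _ = _ := by rw [hcomm, hcomm, mul_assoc V, hcomm]
  have hW (p : ℤ × Fin 3) : Tendsto (fun n => W n D p) atTop (𝓝 0) :=
    tendsto_aeval_chebyshev_U_hopping hb hab p q
  have hWsucc (p : ℤ × Fin 3) : Tendsto (fun n => W (n + 1) D p) atTop (𝓝 0) :=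
    (hW p).comp (tendsto_add_atTop_nat 1)
  intro p
  refine (tendsto_add_atTop_iff_nat 2).1 ?_
  have hlim := ((tendsto_walk_apply hC (tendsto_walk_apply hC hWsucc) p).add
    (tendsto_walk_apply hC hWsucc p)).sub ((tendsto_walk_apply hC hW p).add (hW p))
  simp only [add_zero, sub_zero] at hlim
  refine hlim.congr fun n => ?_
  exact congrArg (fun A : State →L[ℂ] State => A D p) (hpow n).symm

theorem orthogonal_eigenspace_le_decaying (hb : b ≠ 0) (hab : ‖hopping a b‖ ≤ 1)
    (hrec : walk hC * walk hC * (walk hC + 1) =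
      2 * hopping a b * (walk hC * (walk hC + 1)) - (walk hC + 1)) :
    (eigenspace (walk hC : Module.End ℂ State) (-1))ᗮ ≤ decaying (walk hC) := by
  have hle : (decaying (walk hC))ᗮ ≤ eigenspace (walk hC : Module.End ℂ State) (-1) := by
    intro ξ hξ
    have hadjoint : (walk hC + 1).adjoint ξ = 0 := by
      refine eq_zero_of_translate_eq_self two_ne_zero ?_
      set χ := (walk hC + 1).adjoint ξ
      ext ⟨m, l⟩
      have h : inner ℂ χ ((translate 1 - translate (-1)) (basisState (m - 1, l))) = 0 := by
        rw [ContinuousLinearMap.adjoint_inner_left]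
        exact Submodule.inner_left_of_mem_orthogonal
          (walk_add_one_mem_decaying hb hab hrec (m - 1, l)) hξ
      rw [← ContinuousLinearMap.adjoint_inner_left, map_sub, adjoint_translate, adjoint_translate,
        lp.inner_single_right] at h
      have hconj : starRingEnd ℂ (χ (m, l) - χ (m - 2, l)) = 0 := by
        simpa [translate_apply, sub_sub] using h
      rw [translate_apply]
      exact (sub_eq_zero.1 ((map_eq_zero _).1 hconj)).symm
    have hinner : inner ℂ ξ (walk hC ξ) = -1 * inner ℂ ξ ξ := by
      have : inner ℂ ξ ((walk hC + 1) ξ) = 0 := by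
        rw [← ContinuousLinearMap.adjoint_inner_left, hadjoint, inner_zero_left]
      rw [neg_one_mul]
      exact eq_neg_of_add_eq_zero_left ((inner_add_right _ _ _).symm.trans this)
    exact mem_eigenspace_iff.2 (map_eq_smul_of_inner_map_self_eq (norm_walk_le hC) (by simp) hinner)
  have : CompleteSpace (decaying (walk hC)) :=
    (isClosed_decaying (norm_walk_le hC)).completeSpace_coe
  simpa using Submodule.orthogonal_le hle

end Recurrence

end Walk

section Localization

/-- The amplitude of `ψ` at the site `m`, a vector in the coin space. -/
def siteAmplitude (ψ : State) (m : ℤ) : EuclideanSpace ℂ (Fin 3) := WithLp.toLp 2 fun l => ψ (m, l)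

theorem initial_apply (φ : EuclideanSpace ℂ (Fin 3)) (m : ℤ) (l : Fin 3) :
    initial φ (m, l) = if m = 0 then φ l else 0 := by
  rw [initial, lp.coeFn_sum, Finset.sum_apply]
  simp only [lp.single_apply, Pi.single_apply, Prod.mk.injEq]
  by_cases hm : m = 0 <;> simp [hm]

theorem inner_initial_right (ξ : State) (φ : EuclideanSpace ℂ (Fin 3)) :
    inner ℂ ξ (initial φ) = inner ℂ (siteAmplitude ξ 0) φ := by
  rw [initial, inner_sum, PiLp.inner_apply]
  simp only [lp.inner_single_right, siteAmplitude]

theorem tendsto_prob {C : Matrix (Fin 3) (Fin 3) ℂ} (hC : C ∈ Matrix.unitaryGroup (Fin 3) ℂ) {μ : ℂ}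
    (hμ : ‖μ‖ = 1)
    (hdecay : (eigenspace (walk hC : Module.End ℂ State) μ)ᗮ ≤ decaying (walk hC))
    (φ : EuclideanSpace ℂ (Fin 3)) (m : ℤ) :
    Tendsto (prob C φ m) atTop (𝓝 (‖siteAmplitude
      ((eigenspace (walk hC : Module.End ℂ State) μ).starProjection (initial φ)) m‖ ^ 2)) := by
  rw [EuclideanSpace.norm_sq_eq]
  refine tendsto_finsetSum _ fun l _ => ?_
  exact ((tendsto_norm_pow_apply hμ hdecay (initial φ) (m, l)).pow 2).congr fun t => by
    rw [coe_walk_pow]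

theorem siteAmplitude_starProjection_initial_eq_zero_iff (K : Submodule ℂ State)
    [K.HasOrthogonalProjection] (φ : EuclideanSpace ℂ (Fin 3)) :
    siteAmplitude (K.starProjection (initial φ)) 0 = 0 ↔ initial φ ∈ Kᗮ := by
  rw [← Submodule.starProjection_apply_eq_zero_iff]
  refine ⟨fun h => ?_, fun h => by rw [h]; rfl⟩
  rw [← inner_self_eq_zero (𝕜 := ℂ), ← Submodule.inner_starProjection_left_eq_right,
    Submodule.starProjection_eq_self_iff.2 (Submodule.starProjection_apply_mem _ _),
    inner_initial_right, h, inner_zero_left]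

end Localization

section CoinClassY

theorem momentumEvolution_apply (C : Matrix (Fin 3) (Fin 3) ℂ) (k : ℝ)
    (v : EuclideanSpace ℂ (Fin 3)) (l : Fin 3) :
    Matrix.toEuclideanLin (momentumEvolution C k) v l =
      ![Complex.exp (Complex.I * k), 1, Complex.exp (-(Complex.I * k))] l * ∑ j, C l j * v j := by
  rw [momentumEvolution, Matrix.toLpLin_apply, ← Matrix.mulVec_mulVec]
  simp only [Matrix.mulVec_diagonal]
  rfl

theorem mem_coinClassY_iff {x y : ℝ} :
    coin x y ∈ coinClassY ↔ x ^ 2 + y ^ 2 + x + y + x * y = 0 ∧ -1 ≤ x ∧ x ≤ 1 / 3 := by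
  refine ⟨?_, fun ⟨h, hl, hu⟩ => ⟨x, y, h, hl, hu, rfl⟩⟩
  rintro ⟨x', y', h, hl, hu, heq⟩
  obtain rfl : x = x' := congr_fun₂ heq 0 0
  obtain rfl : y = y' := congr_fun₂ heq 0 1
  exact ⟨h, hl, hu⟩

theorem sum_toComplex_coin_mul (x y : ℝ) (v : Fin 3 → ℂ) (l : Fin 3) :
    ∑ j, toComplex (coin x y) l j * v j =
      ![x * v 0 + y * v 1 + (-1 - x - y) * v 2, (-1 - x - y) * v 0 + x * v 1 + y * v 2,
        y * v 0 + (-1 - x - y) * v 1 + x * v 2] l := by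
  fin_cases l <;> simp [toComplex, coin, Fin.sum_univ_three]

theorem inner_exceptionalState_eq_zero {x y : ℝ} {v : EuclideanSpace ℂ (Fin 3)}
    (hrow : ∑ j, toComplex (coin x y) 1 j * v j = -v 1) :
    inner ℂ v (exceptionalState x y) = 0 := by
  have hconj := congrArg (starRingEnd ℂ) hrow
  simp only [sum_toComplex_coin_mul, Matrix.cons_val, map_add, map_mul, map_sub, map_neg, map_one,
    Complex.conj_ofReal] at hconj
  rw [exceptionalState, inner_smul_right, PiLp.inner_apply, Fin.sum_univ_three]
  simp only [RCLike.inner_apply, Matrix.cons_val]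
  exact mul_eq_zero_of_right _ (by linear_combination hconj)

theorem norm_exceptionalState {x : ℝ} (hx : x ≠ -1) (y : ℝ) : ‖exceptionalState x y‖ = 1 := by
  have hx' : 1 + x ≠ 0 := fun h => hx (by linarith)
  have hnorm : ‖(!₂[-(1 + (x : ℂ) + y), 1 + (x : ℂ), (y : ℂ)] : EuclideanSpace ℂ (Fin 3))‖ =
      √((1 + x + y) ^ 2 + (1 + x) ^ 2 + y ^ 2) := by
    rw [EuclideanSpace.norm_eq, Fin.sum_univ_three]
    simp only [Matrix.cons_val, norm_neg, ← Complex.ofReal_one, ← Complex.ofReal_add,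
      Complex.norm_real, Real.norm_eq_abs, sq_abs]
  have hpos : 0 < √((1 + x + y) ^ 2 + (1 + x) ^ 2 + y ^ 2) := Real.sqrt_pos.2 (by positivity)
  rw [exceptionalState, norm_smul, hnorm, Complex.norm_real, Real.norm_of_nonneg (by positivity),
    one_div_mul_cancel hpos.ne']

theorem exists_eq_smul_exceptionalState {x y : ℝ} (hx : x ≠ -1) {φ : EuclideanSpace ℂ (Fin 3)}
    (hD : φ 0 * (1 + x) + φ 1 * (1 + x + y) = 0) (hE : φ 2 * (1 + x) - φ 1 * y = 0) :
    ∃ c : ℂ, φ = c • exceptionalState x y := by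
  have hx' : 1 + x ≠ 0 := fun h => hx (by linarith)
  have hxc : (1 + x : ℂ) ≠ 0 := by exact_mod_cast hx'
  have hN : (√((1 + x + y) ^ 2 + (1 + x) ^ 2 + y ^ 2) : ℂ) ≠ 0 :=
    Complex.ofReal_ne_zero.2 (Real.sqrt_pos.2 (by positivity)).ne'
  refine ⟨√((1 + x + y) ^ 2 + (1 + x) ^ 2 + y ^ 2) * φ 1 / (1 + x), ?_⟩
  ext l
  fin_cases l <;> simp [exceptionalState] <;> field_simp
  · linear_combination hD
  · linear_combination hE

/-- The bound state at the site `m`: an eigenvector of the walk for the eigenvalue `-1`, supported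
on the sites `m` and `m + 1`. -/
def boundState (x y : ℝ) (m : ℤ) : State :=
  translate m (initial !₂[1 + (x : ℂ), 1 + (x : ℂ) + y, 0]) +
    translate (m + 1) (initial !₂[0, -(y : ℂ), 1 + (x : ℂ)])

theorem boundState_apply (x y : ℝ) (m n : ℤ) (l : Fin 3) :
    boundState x y m (n, l) =
      (if n = m then ![1 + (x : ℂ), 1 + (x : ℂ) + y, 0] l else 0) +
        if n = m + 1 then ![0, -(y : ℂ), 1 + (x : ℂ)] l else 0 := by
  simp only [boundState, lp.coeFn_add, Pi.add_apply, translate_apply, initial_apply, sub_eq_zero]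

theorem inner_boundState_zero_initial (x y : ℝ) (φ : EuclideanSpace ℂ (Fin 3)) :
    inner ℂ (boundState x y 0) (initial φ) = φ 0 * (1 + x) + φ 1 * (1 + x + y) := by
  rw [inner_initial_right, PiLp.inner_apply, Fin.sum_univ_three]
  simp [siteAmplitude, boundState_apply]

theorem inner_boundState_neg_one_initial (x y : ℝ) (φ : EuclideanSpace ℂ (Fin 3)) :
    inner ℂ (boundState x y (-1)) (initial φ) = φ 2 * (1 + x) - φ 1 * y := by
  rw [inner_initial_right, PiLp.inner_apply, Fin.sum_univ_three]
  simp [siteAmplitude, boundState_apply, neg_add_eq_sub]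

theorem initial_smul_exceptionalState_mem_orthogonal (x y : ℝ) (c : ℂ) :
    initial (c • exceptionalState x y) ∈
      (eigenspace (evolution (toComplex (coin x y))) (-1))ᗮ := by
  refine (Submodule.mem_orthogonal _ _).2 fun ξ hξ => ?_
  rw [mem_eigenspace_iff, neg_one_smul] at hξ
  have hrow : inner ℂ (siteAmplitude ξ 0) (exceptionalState x y) = 0 :=
    inner_exceptionalState_eq_zero (congrArg (fun ψ : State => ψ (0, 1)) hξ)
  rw [inner_initial_right, inner_smul_right, hrow, mul_zero]

theorem inner_exceptionalState_eq_zero_of_momentumEvolution {x y k : ℝ}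
    {v : EuclideanSpace ℂ (Fin 3)}
    (hv : Matrix.toEuclideanLin (momentumEvolution (toComplex (coin x y)) k) v = -v) :
    inner ℂ v (exceptionalState x y) = 0 := by
  refine inner_exceptionalState_eq_zero ?_
  have hrow := congrArg (fun u : EuclideanSpace ℂ (Fin 3) => u 1) hv
  simpa only [momentumEvolution_apply, Matrix.cons_val, one_mul, PiLp.neg_apply] using hrow

variable {x y : ℝ} (h : x ^ 2 + y ^ 2 + x + y + x * y = 0)
include h

theorem toComplex_coin_mem_unitaryGroup :
    toComplex (coin x y) ∈ Matrix.unitaryGroup (Fin 3) ℂ := by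
  have hc : (x : ℂ) ^ 2 + y ^ 2 + x + y + x * y = 0 := by exact_mod_cast h
  rw [Matrix.mem_unitaryGroup_iff]
  ext i j
  fin_cases i <;> fin_cases j <;>
    simp only [Matrix.mul_apply, Fin.sum_univ_three, Matrix.star_apply, toComplex, coin,
      Matrix.map_apply, Matrix.of_apply, Matrix.cons_val, RCLike.star_def, Complex.conj_ofReal,
      Complex.ofReal_sub, Complex.ofReal_neg, Complex.ofReal_one, Matrix.one_fin_three,
      Fin.zero_eta, Fin.mk_one, Fin.reduceFinMk] <;>
    first | linear_combination 2 * hc | linear_combination -hc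

/- The Cayley–Hamilton theorem in momentum space: the characteristic polynomial of
`momentumEvolution` is `(λ + 1) (λ² - (1 + x + 2 x cos k) λ + 1)`. -/
theorem walk_coin_recurrence :
    let V := walk (toComplex_coin_mem_unitaryGroup h)
    V * V * (V + 1) = 2 * hopping ((1 + x) / 2) (x / 2) * (V * (V + 1)) - (V + 1) := by
  intro V
  have hc : (x : ℂ) ^ 2 + y ^ 2 + x + y + x * y = 0 := by exact_mod_cast h
  ext η ⟨m, l⟩
  have hsum : (V η (m, l) + V η (m + 1, l) + V η (m - 1, l) + 3 * η (m, l)) *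
      ((x : ℂ) ^ 2 + y ^ 2 + x + y + x * y) = 0 := by rw [hc, mul_zero]
  fin_cases l <;>
  · simp only [V, two_mul, add_mul, walk_apply, mul_apply_eq_comp, add_apply, sub_apply,
      one_apply_eq_self, map_add, lp.coeFn_add, lp.coeFn_sub, Pi.add_apply, Pi.sub_apply,
      hopping_apply, evolution_apply, sum_toComplex_coin_mul, disp, Matrix.cons_val, Fin.zero_eta,
      Fin.mk_one, Fin.reduceFinMk, add_sub_cancel_right, sub_add_cancel, sub_neg_eq_add,
      sub_zero] at hsum ⊢
    push_cast
    linear_combination -hsum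

theorem orthogonal_eigenspace_coin_le_decaying (hl : -1 ≤ x) (hu : x ≤ 1 / 3) (hx : x ≠ 0) :
    let V := walk (toComplex_coin_mem_unitaryGroup h)
    (eigenspace (V : Module.End ℂ State) (-1))ᗮ ≤ decaying V := by
  have hnorm : ‖hopping ((1 + x) / 2) (x / 2)‖ ≤ 1 := by
    refine (norm_hopping_le _ _).trans ?_
    rw [abs_of_nonneg (by linarith)]
    rcases abs_cases (x / 2) with ⟨habs, -⟩ | ⟨habs, -⟩ <;> linarith
  exact orthogonal_eigenspace_le_decaying (by simpa using hx) hnorm (walk_coin_recurrence h)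

theorem evolution_boundState (m : ℤ) :
    evolution (toComplex (coin x y)) (boundState x y m) = -boundState x y m := by
  have hc : (x : ℂ) ^ 2 + y ^ 2 + x + y + x * y = 0 := by exact_mod_cast h
  ext ⟨n, l⟩
  fin_cases l
  all_goals
    simp only [evolution_apply, sum_toComplex_coin_mul, lp.coeFn_neg, Pi.neg_apply,
      boundState_apply, disp, Matrix.cons_val, Fin.zero_eta, Fin.mk_one, Fin.reduceFinMk,
      sub_neg_eq_add, sub_zero]
    split_ifs
    all_goals first | omega | ring1 | linear_combination hc | linear_combination -hc

theorem initial_mem_orthogonal_eigenspace_tfae (hx : x ≠ -1) {φ : EuclideanSpace ℂ (Fin 3)}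
    (hφ : ‖φ‖ = 1) :
    [initial φ ∈ (eigenspace (evolution (toComplex (coin x y))) (-1))ᗮ,
      ∃ c : ℂ, ‖c‖ = 1 ∧ φ = c • exceptionalState x y,
      φ 0 * (1 + x) + φ 1 * (1 + x + y) = 0 ∧ φ 2 * (1 + x) - φ 1 * y = 0].TFAE := by
  tfae_have 1 → 3 := fun horth => by
    have hbound (m : ℤ) : inner ℂ (boundState x y m) (initial φ) = 0 :=
      Submodule.inner_right_of_mem_orthogonal
        (mem_eigenspace_iff.2 ((evolution_boundState h m).trans (neg_one_smul ℂ _).symm)) horth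
    exact ⟨inner_boundState_zero_initial x y φ ▸ hbound 0,
      inner_boundState_neg_one_initial x y φ ▸ hbound (-1)⟩
  tfae_have 3 → 2 := fun ⟨hD, hE⟩ => by
    obtain ⟨c, rfl⟩ := exists_eq_smul_exceptionalState hx hD hE
    rw [norm_smul, norm_exceptionalState hx, mul_one] at hφ
    exact ⟨c, hφ, rfl⟩
  tfae_have 2 → 1
  | ⟨c, _, hc⟩ => hc ▸ initial_smul_exceptionalState_mem_orthogonal x y c
  tfae_finish

theorem hasEigenvalue_momentumEvolution (hx : x ≠ -1) (k : ℝ) :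
    HasEigenvalue (Matrix.toEuclideanLin (momentumEvolution (toComplex (coin x y)) k)) (-1) := by
  have hc : (x : ℂ) ^ 2 + y ^ 2 + x + y + x * y = 0 := by exact_mod_cast h
  have hx' : 1 + x ≠ 0 := fun h => hx (by linarith)
  have hxc : (1 + x : ℂ) ≠ 0 := by exact_mod_cast hx'
  have hexp : Complex.exp (Complex.I * k) * Complex.exp (-(Complex.I * k)) = 1 := by
    rw [← Complex.exp_add, add_neg_cancel, Complex.exp_zero]
  -- The Fourier transform of `boundState x y 0`.
  refine hasEigenvalue_of_hasEigenvector (x := !₂[1 + (x : ℂ), 1 + (x : ℂ) + y, 0] +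
    Complex.exp (-(Complex.I * k)) • !₂[0, -(y : ℂ), 1 + (x : ℂ)]) (hasEigenvector_iff.2 ⟨?_, ?_⟩)
  · rw [mem_eigenspace_iff]
    ext l
    rw [momentumEvolution_apply, sum_toComplex_coin_mul]
    generalize Complex.exp (Complex.I * k) = w, Complex.exp (-(Complex.I * k)) = w' at hexp ⊢
    fin_cases l <;>
      simp only [Matrix.cons_val, PiLp.add_apply, PiLp.smul_apply, PiLp.neg_apply, neg_smul,
        one_smul, smul_eq_mul, Fin.zero_eta, Fin.mk_one, Fin.reduceFinMk]
    · linear_combination (w - w * w') * hc - (1 + x) * hexp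
    · ring
    · linear_combination (w' ^ 2 - w') * hc
  · intro h0
    have := congr_fun (congrArg WithLp.ofLp h0) 0
    simp [hxc] at this

end CoinClassY

end ThreeStateWalk

end

theorem mainTheorem4 (x y : ℝ) (hC : ThreeStateWalk.coin x y ∈ ThreeStateWalk.coinClassY)
    (hx0 : x ≠ 0) (hx1 : x ≠ -1) :
    -- the limit of the return probability exists, and vanishes exactly for one coin state
    -- (up to a global phase), which is the one with `D = E = 0`
    (∀ φ : EuclideanSpace ℂ (Fin 3), ‖φ‖ = 1 →
      ∃ L : ℝ,
        Tendsto (fun t : ℕ =>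
          ThreeStateWalk.prob (ThreeStateWalk.toComplex (ThreeStateWalk.coin x y)) φ 0 t)
          atTop (𝓝 L) ∧
        (L = 0 ↔ ∃ c : ℂ, ‖c‖ = 1 ∧ φ = c • ThreeStateWalk.exceptionalState x y) ∧
        (L = 0 ↔ φ 0 * (1 + x) + φ 1 * (1 + x + y) = 0 ∧ φ 2 * (1 + x) - φ 1 * y = 0)) ∧
    -- `-1` is an eigenvalue for every momentum, and this state is orthogonal to its eigenvectors
    (∀ k : ℝ,
      Module.End.HasEigenvalue (Matrix.toEuclideanLin (ThreeStateWalk.momentumEvolution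
        (ThreeStateWalk.toComplex (ThreeStateWalk.coin x y)) k)) (-1) ∧
      ∀ v : EuclideanSpace ℂ (Fin 3),
        Matrix.toEuclideanLin (ThreeStateWalk.momentumEvolution
          (ThreeStateWalk.toComplex (ThreeStateWalk.coin x y)) k) v = -v →
        inner ℂ v (ThreeStateWalk.exceptionalState x y) = 0) := by
  obtain ⟨h, hl, hu⟩ := ThreeStateWalk.mem_coinClassY_iff.1 hC
  refine ⟨fun φ hφ => ?_, fun k => ⟨ThreeStateWalk.hasEigenvalue_momentumEvolution h hx1 k,
    fun v hv => ThreeStateWalk.inner_exceptionalState_eq_zero_of_momentumEvolution hv⟩⟩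
  have hlim := ThreeStateWalk.tendsto_prob (ThreeStateWalk.toComplex_coin_mem_unitaryGroup h)
    (by simp) (ThreeStateWalk.orthogonal_eigenspace_coin_le_decaying h hl hu hx0) φ 0
  have htfae := ThreeStateWalk.initial_mem_orthogonal_eigenspace_tfae h hx1 hφ
  refine ⟨_, hlim, ?_⟩
  rw [sq_eq_zero_iff, norm_eq_zero,
    ThreeStateWalk.siteAmplitude_starProjection_initial_eq_zero_iff]
  exact ⟨htfae.out 0 1, htfae.out 0 2⟩
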